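/- For $n\ge 3$ let $\mathcal D_n=\mathcal D_n(a,b,c,d)$ be the DFA with state set $\{1,\dots,n\}$, alphabet $\Sigma=\{a,b,c,d\}$, initial state $1$, only final state $n$, and transitions given by the following transformations of the states: $a$ acts as the cycle $(1,2,\dots,n-1)$, $b$ as the cycle $(2,\dots,n-1)$ (the identity if $n=3$), $c$ maps $n-1$ to $1$ and fixes all other states, and $d$ maps $n-1$ to $n$ and fixes all other states. Let $L_n=L_n(a,b,c,d)$ be the language accepted by $\mathcal D_n$. For a partial permutation $\pi$ of $\Sigma$ (a bijection between two subsets of $\Sigma$), the dialect $L_n(\pi(a),\pi(b),\pi(c),\pi(d))$ is the language over the alphabet $\pi(\Sigma)$ obtained from $L_n$ by discarding the words that contain a letter on which $\pi$ is undefined and replacing each letter $x$ by $\pi(x)$ in the remaining words; an undefined value is written $-$. Thus $L_n(a,b,-,d)$ and $L_n(b,a,-,d)$ are languages over $\{a,b,d\}$, and in the latter the letters $a$ and $b$ have exchanged their roles. The complexity of a regular language $L$ over an alphabet $\Gamma$ is the number of its distinct left quotients $w^{-1}L=\{x\in\Gamma^*\mid wx\in L\}$, $w\in\Gamma^*$.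 **Theorem (Right Ideals: Boolean Operations).** Let $m,n\ge 3$. Over the alphabet $\{a,b,d\}$: 1. the complexity of $L_m(a,b,-,d)\cap L_n(b,a,-,d)$ is $mn$; 2. the complexity of the symmetric difference $L_m(a,b,-,d)\oplus L_n(b,a,-,d)$ is $mn$; 3. the complexity of $L_m(a,b,-,d)\setminus L_n(b,a,-,d)$ is $mn-(m-1)$; 4. the complexity of $L_m(a,b,-,d)\cup L_n(b,a,-,d)$ is $mn-(m+n-2)$. -/

import Mathlib

/-- The quotient complexity of a language `L` over the alphabet `α`: the number of distinct left
quotients `w⁻¹L = {x | w x ∈ L}` for words `w` over `α` (an element of `ℕ∞`, so that a natural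
number as value includes finiteness, i.e. regularity of `L`). -/
noncomputable def quotientComplexity {α : Type*} (L : Language α) : ℕ∞ :=
  (Set.range L.leftQuotient).encard

/-- The permutational dialect `s_π(L)` of `L` under a partial permutation `π` of the alphabet:
each letter `x` is substituted by `π x` if `π x` is defined, and by the empty language otherwise.
So only those words of `L` contribute on all of whose letters `π` is defined. -/
def dialect {α : Type*} (π : α ≃. α) (L : Language α) : Language α :=
  {w | ∃ v ∈ L, v.map π = w.map some}

/-- A language, considered over the subalphabet `Γ`. -/
def overAlphabet {α : Type*} (Γ : Set α) (L : Language α) : Language Γ :=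
  {w | w.map Subtype.val ∈ L}

/-- The letters occurring in words of a dialect all lie in the range of `π`. -/
theorem exists_of_mem_dialect {α : Type*} {π : α ≃. α} {L : Language α} {w : List α}
    (hw : w ∈ dialect π L) {x : α} (hx : x ∈ w) : ∃ y, π y = some x := by
  obtain ⟨v, -, hv⟩ := hw
  have h : some x ∈ v.map π := by
    rw [hv]
    exact List.mem_map_of_mem hx
  obtain ⟨y, -, hy⟩ := List.mem_map.1 h
  exact ⟨y, hy⟩

/-- The four-letter alphabet `{a, b, c, d}`. -/
inductive Letter : Type
  | a | b | c | d
  deriving DecidableEq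

/-- The subalphabet `{a, b, d}`. -/
def alphabetABD : Set Letter := {Letter.a, Letter.b, Letter.d}

/-- The DFA `D_n(a, b, c, d)`, `n ≥ 3`. Its states are `1, …, n`, where the state `q` is
represented by the element `q - 1` of `Fin n`. The letters induce the transformations
`a : (1, 2, …, n-1)` and `b : (2, …, n-1)` (cycles), `c : (n-1 → 1)` and `d : (n-1 → n)`.
The initial state is `1` and the only final state is `n`. -/
def rightIdealDFA (n : ℕ) (hn : 3 ≤ n) : DFA Letter (Fin n) where
  step q
    | Letter.a =>
        if h : q.val + 2 < n then ⟨q.val + 1, by omega⟩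
        else if q.val + 2 = n then ⟨0, by omega⟩ else q
    | Letter.b =>
        if h : 1 ≤ q.val ∧ q.val + 2 < n then ⟨q.val + 1, by omega⟩
        else if q.val + 2 = n then ⟨1, by omega⟩ else q
    | Letter.c => if q.val + 2 = n then ⟨0, by omega⟩ else q
    | Letter.d => if h : q.val + 2 = n then ⟨q.val + 1, by omega⟩ else q
  start := ⟨0, by omega⟩
  accept := {⟨n - 1, by omega⟩}

/-- The language `L_n(a, b, c, d)` accepted by `D_n(a, b, c, d)`. -/
def rightIdealLang (n : ℕ) (hn : 3 ≤ n) : Language Letter := (rightIdealDFA n hn).accepts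

/-- The partial permutation `a ↦ a, b ↦ b, c ↦ -, d ↦ d` of `{a, b, c, d}`. -/
def permAB : Letter ≃. Letter where
  toFun
    | Letter.a => some Letter.a
    | Letter.b => some Letter.b
    | Letter.c => none
    | Letter.d => some Letter.d
  invFun
    | Letter.a => some Letter.a
    | Letter.b => some Letter.b
    | Letter.c => none
    | Letter.d => some Letter.d
  inv x y := by cases x <;> cases y <;> simp

/-- The partial permutation `a ↦ b, b ↦ a, c ↦ -, d ↦ d` of `{a, b, c, d}`. -/
def permBA : Letter ≃. Letter where
  toFun
    | Letter.a => some Letter.b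
    | Letter.b => some Letter.a
    | Letter.c => none
    | Letter.d => some Letter.d
  invFun
    | Letter.a => some Letter.b
    | Letter.b => some Letter.a
    | Letter.c => none
    | Letter.d => some Letter.d
  inv x y := by cases x <;> cases y <;> simp

/-- The alphabet of the dialects for `permAB` is `{a, b, d}`. -/
theorem range_permAB : {x | ∃ y, permAB y = some x} = alphabetABD := by
  ext x
  constructor
  · rintro ⟨y, hy⟩
    cases y <;> simp [permAB, DFunLike.coe, alphabetABD] at hy ⊢ <;> simp [← hy]
  · rintro (rfl | rfl | rfl)
    exacts [⟨Letter.a, rfl⟩, ⟨Letter.b, rfl⟩, ⟨Letter.d, rfl⟩]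

/-- The alphabet of the dialects for `permBA` is `{a, b, d}`. -/
theorem range_permBA : {x | ∃ y, permBA y = some x} = alphabetABD := by
  ext x
  constructor
  · rintro ⟨y, hy⟩
    cases y <;> simp [permBA, DFunLike.coe, alphabetABD] at hy ⊢ <;> simp [← hy]
  · rintro (rfl | rfl | rfl)
    exacts [⟨Letter.b, rfl⟩, ⟨Letter.a, rfl⟩, ⟨Letter.d, rfl⟩]

/-- The dialect `L_n(a, b, -, d)`, a language over `{a, b, d}`. -/
def langAB (n : ℕ) (hn : 3 ≤ n) : Language alphabetABD :=
  overAlphabet alphabetABD (dialect permAB (rightIdealLang n hn))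

/-- The dialect `L_n(b, a, -, d)`, a language over `{a, b, d}`. -/
def langBA (n : ℕ) (hn : 3 ≤ n) : Language alphabetABD :=
  overAlphabet alphabetABD (dialect permBA (rightIdealLang n hn))

/-!
In each of the two automata the final state is a sink, and `d` only moves one state, into this sink.
On the other states, one of `a` and `b` is a permutation whose powers act transitively, while the
other permutes them fixing the initial state, and these roles are exchanged between the two
automata. So once a component is in its initial state, one letter rotates the other component
without disturbing it, and `d` then sends any chosen state of the other component to its sink. This
reaches every pair of states and distinguishes any two pairs which the Boolean operation does not
identify for trivial reasons: a pair with a final component is a sink for the union, and a pair with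
final second component is dead for the difference.
-/

section General

variable {α σ τ X Y : Type*}

theorem evalFrom_eq_self_of_step_eq_self {M : DFA α σ} {s : σ} {w : List α}
    (h : ∀ x ∈ w, M.step s x = s) : M.evalFrom s w = s := by
  induction w with
  | nil => rfl
  | cons x w ih =>
    rw [DFA.evalFrom_cons, h x List.mem_cons_self]
    exact ih fun y hy => h y (List.mem_cons_of_mem x hy)

theorem bijective_evalFrom {M : DFA α σ} {w : List α}
    (h : ∀ x ∈ w, Function.Bijective (M.step · x)) : Function.Bijective (M.evalFrom · w) := by
  induction w with
  | nil => exact Function.bijective_id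
  | cons x w ih =>
    exact (ih fun y hy => h y (List.mem_cons_of_mem x hy)).comp (h x List.mem_cons_self)

/-- The Boolean operation on languages given by the connective `φ`. -/
def boolOp (φ : Prop → Prop → Prop) (L K : Language α) : Language α :=
  {w | φ (w ∈ L) (w ∈ K)}

theorem mem_boolOp {φ : Prop → Prop → Prop} {L K : Language α} {w : List α} :
    w ∈ boolOp φ L K ↔ φ (w ∈ L) (w ∈ K) :=
  Iff.rfl

theorem leftQuotient_boolOp (φ : Prop → Prop → Prop) (L K : Language α) (w : List α) :
    (boolOp φ L K).leftQuotient w = boolOp φ (L.leftQuotient w) (K.leftQuotient w) :=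
  rfl

theorem quotientComplexity_boolOp_accepts {M : DFA α σ} {N : DFA α τ}
    (h : Function.Surjective fun w => (M.eval w, N.eval w)) (φ : Prop → Prop → Prop) :
    quotientComplexity (boolOp φ M.accepts N.accepts) =
      (Set.range fun s : σ × τ => boolOp φ (M.acceptsFrom s.1) (N.acceptsFrom s.2)).encard := by
  rw [quotientComplexity, ← h.range_comp]
  congr 2
  funext w
  simp only [Function.comp_apply, leftQuotient_boolOp, Language.leftQuotient_accepts_apply]

theorem encard_range_of_injective {F : X → Y} (hF : Function.Injective F) :
    (Set.range F).encard = ENat.card X := by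
  rw [← Set.image_univ, hF.encard_image, Set.encard_univ]

theorem encard_range_of_constant_off {F : X → Y} {C : Set X} (hC : Cᶜ.Nonempty)
    (hconst : ∀ s ∉ C, ∀ t ∉ C, F s = F t) (hsep : ∀ s ∈ C, ∀ t, F s = F t → s = t) :
    (Set.range F).encard = C.encard + 1 := by
  obtain ⟨k, hk⟩ := hC
  have hrange : Set.range F = insert (F k) (F '' C) := by
    refine subset_antisymm ?_ (Set.insert_subset ⟨k, rfl⟩ (Set.image_subset_range F C))
    rintro _ ⟨s, rfl⟩
    by_cases hs : s ∈ C
    · exact Or.inr ⟨s, hs, rfl⟩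
    · exact Or.inl (hconst s hs k hk)
  have hk' : F k ∉ F '' C := by
    rintro ⟨s, hs, hsk⟩
    exact hk (hsep s hs k hsk ▸ hs)
  rw [hrange, Set.encard_insert_of_notMem hk',
    Set.InjOn.encard_image fun s hs t _ hst => hsep s hs t hst]

theorem encard_compl_singleton (x : X) : ({x}ᶜ : Set X).encard = ENat.card X - 1 := by
  rw [Set.compl_eq_univ_sdiff, Set.encard_sdiff_singleton_of_mem (Set.mem_univ x), Set.encard_univ]

end General

/-- The properties of the automata `D_n(a, b, -, d)` on which the theorem rests: the final state `f`
is a sink, `a` permutes the states and its powers act transitively on the states other than `f`,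
`b` is a permutation fixing the initial state, and `d` moves only the state `e`, to `f`. Exchanging
the arguments `a` and `b` describes `D_n(b, a, -, d)`. -/
structure IsRightIdealWitness {α σ : Type*} (M : DFA α σ) (a b d : α) (e f : σ) : Prop where
  accept_eq : M.accept = {f}
  step_final (x : α) : M.step f x = f
  bijective_step_a : Function.Bijective (M.step · a)
  exists_replicate_a {p q : σ} (hp : p ≠ f) (hq : q ≠ f) :
    ∃ k, M.evalFrom p (List.replicate k a) = q
  bijective_step_b : Function.Bijective (M.step · b)
  step_start_b : M.step M.start b = M.start
  step_exit_d : M.step e d = f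
  step_d_of_ne {p : σ} (hp : p ≠ e) : M.step p d = p
  start_ne_exit : M.start ≠ e
  start_ne_final : M.start ≠ f
  exit_ne_final : e ≠ f

namespace IsRightIdealWitness

section Single

variable {α σ : Type*} {M : DFA α σ} {a b d : α} {e f : σ}

theorem mem_acceptsFrom_iff (hM : IsRightIdealWitness M a b d e f) {p : σ} {w : List α} :
    w ∈ M.acceptsFrom p ↔ M.evalFrom p w = f := by
  rw [DFA.mem_acceptsFrom, hM.accept_eq, Set.mem_singleton_iff]

theorem evalFrom_final (hM : IsRightIdealWitness M a b d e f) (w : List α) :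
    M.evalFrom f w = f :=
  evalFrom_eq_self_of_step_eq_self fun x _ => hM.step_final x

theorem mem_acceptsFrom_final (hM : IsRightIdealWitness M a b d e f) (w : List α) :
    w ∈ M.acceptsFrom f :=
  hM.mem_acceptsFrom_iff.2 (hM.evalFrom_final w)

theorem evalFrom_start_replicate_b (hM : IsRightIdealWitness M a b d e f) (k : ℕ) :
    M.evalFrom M.start (List.replicate k b) = M.start :=
  evalFrom_eq_self_of_step_eq_self fun x hx => by
    rw [List.eq_of_mem_replicate hx, hM.step_start_b]

theorem step_start_d (hM : IsRightIdealWitness M a b d e f) : M.step M.start d = M.start :=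
  hM.step_d_of_ne hM.start_ne_exit

theorem bijective_evalFrom_replicate_a (hM : IsRightIdealWitness M a b d e f) (k : ℕ) :
    Function.Bijective (M.evalFrom · (List.replicate k a)) :=
  bijective_evalFrom fun _ hx => List.eq_of_mem_replicate hx ▸ hM.bijective_step_a

theorem bijective_evalFrom_replicate_b (hM : IsRightIdealWitness M a b d e f) (k : ℕ) :
    Function.Bijective (M.evalFrom · (List.replicate k b)) :=
  bijective_evalFrom fun _ hx => List.eq_of_mem_replicate hx ▸ hM.bijective_step_b

theorem evalFrom_ne_final (hM : IsRightIdealWitness M a b d e f) {w : List α}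
    (hw : Function.Bijective (M.evalFrom · w)) {p : σ} (hp : p ≠ f) : M.evalFrom p w ≠ f :=
  fun h => hp (hw.injective (h.trans (hM.evalFrom_final w).symm))

theorem injOn_step_d (hM : IsRightIdealWitness M a b d e f) :
    Set.InjOn (M.step · d) {f}ᶜ := by
  intro p hp q hq h
  by_cases hpe : p = e <;> by_cases hqe : q = e
  · exact hpe.trans hqe.symm
  · have hqf : q = f := by simpa only [hpe, hM.step_exit_d, hM.step_d_of_ne hqe] using h.symm
    exact absurd hqf hq
  · have hpf : p = f := by simpa only [hqe, hM.step_exit_d, hM.step_d_of_ne hpe] using h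
    exact absurd hpf hp
  · simpa only [hM.step_d_of_ne hpe, hM.step_d_of_ne hqe] using h

theorem exists_replicate_a_d_separates (hM : IsRightIdealWitness M a b d e f) {p p' : σ}
    (hpp' : p ≠ p') (hp : p ≠ f) (hp' : p' ≠ f) :
    ∃ k, M.evalFrom p (List.replicate k a ++ [d]) ≠ f ∧
      M.evalFrom p' (List.replicate k a ++ [d]) = f := by
  obtain ⟨k, hk⟩ := hM.exists_replicate_a hp' hM.exit_ne_final
  have hpe : M.evalFrom p (List.replicate k a) ≠ e := fun h =>
    hpp' ((hM.bijective_evalFrom_replicate_a k).injective (h.trans hk.symm))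
  refine ⟨k, ?_, ?_⟩
  · rw [DFA.evalFrom_append_singleton, hM.step_d_of_ne hpe]
    exact hM.evalFrom_ne_final (hM.bijective_evalFrom_replicate_a k) hp
  · rw [DFA.evalFrom_append_singleton, hk, hM.step_exit_d]

theorem injective_acceptsFrom (hM : IsRightIdealWitness M a b d e f) :
    Function.Injective M.acceptsFrom := by
  intro p p' h
  have hiff (w : List α) : M.evalFrom p w = f ↔ M.evalFrom p' w = f := by
    rw [← hM.mem_acceptsFrom_iff, h, hM.mem_acceptsFrom_iff]
  have hnil : p = f ↔ p' = f := hiff []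
  by_contra hpp'
  by_cases hp : p = f
  · exact hpp' (hp.trans (hnil.1 hp).symm)
  · obtain ⟨k, hk, hk'⟩ := hM.exists_replicate_a_d_separates hpp' hp (mt hnil.2 hp)
    exact hk ((hiff _).2 hk')

theorem comap {β : Type*} {g : β → α} {a b d : β}
    (hM : IsRightIdealWitness M (g a) (g b) (g d) e f) :
    IsRightIdealWitness (M.comap g) a b d e f where
  accept_eq := hM.accept_eq
  step_final x := hM.step_final (g x)
  bijective_step_a := hM.bijective_step_a
  exists_replicate_a hp hq := by
    simpa only [DFA.evalFrom_comap, List.map_replicate] using hM.exists_replicate_a hp hq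
  bijective_step_b := hM.bijective_step_b
  step_start_b := hM.step_start_b
  step_exit_d := hM.step_exit_d
  step_d_of_ne := hM.step_d_of_ne
  start_ne_exit := hM.start_ne_exit
  start_ne_final := hM.start_ne_final
  exit_ne_final := hM.exit_ne_final

end Single

section Pair

variable {α σ τ : Type*} {M : DFA α σ} {N : DFA α τ} {a b d : α} {e f : σ} {e' f' : τ}

theorem exists_evalFrom_eq_start_start (hM : IsRightIdealWitness M a b d e f)
    (hN : IsRightIdealWitness N b a d e' f') {p : σ} {q : τ} (hp : p ≠ f) (hq : q ≠ f') :
    ∃ w, M.evalFrom p w = M.start ∧ N.evalFrom q w = N.start := by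
  obtain ⟨k, hk⟩ := hN.exists_replicate_a hq hN.start_ne_final
  obtain ⟨j, hj⟩ := hM.exists_replicate_a
    (hM.evalFrom_ne_final (hM.bijective_evalFrom_replicate_b k) hp) hM.start_ne_final
  refine ⟨List.replicate k b ++ List.replicate j a, ?_, ?_⟩
  · rw [DFA.evalFrom_of_append, hj]
  · rw [DFA.evalFrom_of_append, hk, hN.evalFrom_start_replicate_b]

theorem exists_eval_eq_start_final (hM : IsRightIdealWitness M a b d e f)
    (hN : IsRightIdealWitness N b a d e' f') :
    ∃ w, M.eval w = M.start ∧ N.eval w = f' := by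
  obtain ⟨k, hk⟩ := hN.exists_replicate_a hN.start_ne_final hN.exit_ne_final
  refine ⟨List.replicate k b ++ [d], ?_, ?_⟩
  · rw [DFA.eval_append_singleton, DFA.eval, hM.evalFrom_start_replicate_b, hM.step_start_d]
  · rw [DFA.eval_append_singleton, DFA.eval, hk, hN.step_exit_d]

theorem exists_eval_eq_of_ne_final (hM : IsRightIdealWitness M a b d e f)
    (hN : IsRightIdealWitness N b a d e' f') {p : σ} {q : τ} (hp : p ≠ f) (hq : q ≠ f') :
    ∃ w, M.eval w = p ∧ N.eval w = q := by
  obtain ⟨k, hk⟩ := hN.exists_replicate_a hN.start_ne_final hq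
  obtain ⟨p', rfl⟩ := (hM.bijective_evalFrom_replicate_b k).surjective p
  have hp' : p' ≠ f := by
    rintro rfl
    exact hp (hM.evalFrom_final _)
  obtain ⟨j, hj⟩ := hM.exists_replicate_a hM.start_ne_final hp'
  refine ⟨List.replicate j a ++ List.replicate k b, ?_, ?_⟩
  · rw [DFA.eval, DFA.evalFrom_of_append, hj]
  · rw [DFA.eval, DFA.evalFrom_of_append, hN.evalFrom_start_replicate_b, hk]

theorem exists_eval_eq_final_left (hM : IsRightIdealWitness M a b d e f)
    (hN : IsRightIdealWitness N b a d e' f') (q : τ) :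
    ∃ w, M.eval w = f ∧ N.eval w = q := by
  obtain ⟨u, hu', hu⟩ := hN.exists_eval_eq_start_final hM
  have hreach (v : List α) : M.eval (u ++ v) = f ∧ N.eval (u ++ v) = N.evalFrom N.start v := by
    simp only [DFA.eval, DFA.evalFrom_of_append] at hu hu' ⊢
    rw [hu, hu']
    exact ⟨hM.evalFrom_final v, rfl⟩
  by_cases hq : q = f'
  · obtain ⟨v, -, hv⟩ := hM.exists_eval_eq_start_final hN
    exact ⟨u ++ v, (hreach v).1, (hreach v).2.trans (hv.trans hq.symm)⟩
  · obtain ⟨k, hk⟩ := hN.exists_replicate_a hN.start_ne_final hq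
    exact ⟨_, (hreach _).1, (hreach _).2.trans hk⟩

theorem surjective_eval_prod (hM : IsRightIdealWitness M a b d e f)
    (hN : IsRightIdealWitness N b a d e' f') :
    Function.Surjective fun w => (M.eval w, N.eval w) := by
  rintro ⟨p, q⟩
  simp only [Prod.mk.injEq]
  by_cases hp : p = f
  · exact hp ▸ hM.exists_eval_eq_final_left hN q
  by_cases hq : q = f'
  · obtain ⟨w, hw, hw'⟩ := hN.exists_eval_eq_final_left hM p
    exact ⟨w, hw', hw.trans hq.symm⟩
  · exact hM.exists_eval_eq_of_ne_final hN hp hq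

theorem exists_evalFrom_ne_and_eq_final (hM : IsRightIdealWitness M a b d e f)
    (hN : IsRightIdealWitness N b a d e' f') {p p' : σ} (hpp' : p ≠ p') (q : τ) :
    ∃ w, M.evalFrom p w ≠ M.evalFrom p' w ∧ N.evalFrom q w = f' := by
  by_cases hq : q = f'
  · exact ⟨[], hpp', hq⟩
  wlog hp : p ≠ f generalizing p p'
  · obtain ⟨w, h, h'⟩ := this hpp'.symm fun hp' => hpp' ((not_not.1 hp).trans hp'.symm)
    exact ⟨w, h.symm, h'⟩
  by_cases hp' : p' = f
  · obtain ⟨u, hu, hu'⟩ := hM.exists_evalFrom_eq_start_start hN hp hq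
    obtain ⟨v, hv, hv'⟩ := hM.exists_eval_eq_start_final hN
    refine ⟨u ++ v, ?_, ?_⟩
    · rw [hp', hM.evalFrom_final, DFA.evalFrom_of_append, hu]
      exact hv.trans_ne hM.start_ne_final
    · rw [DFA.evalFrom_of_append, hu']
      exact hv'
  · obtain ⟨k, hk⟩ := hN.exists_replicate_a hq hN.exit_ne_final
    have hb := hM.bijective_evalFrom_replicate_b k
    refine ⟨List.replicate k b ++ [d], ?_, ?_⟩
    · rw [DFA.evalFrom_append_singleton, DFA.evalFrom_append_singleton]
      exact hM.injOn_step_d.ne (hM.evalFrom_ne_final hb hp) (hM.evalFrom_ne_final hb hp')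
        (hb.injective.ne hpp')
    · rw [DFA.evalFrom_append_singleton, hk, hN.step_exit_d]

theorem exists_not_mem_iff_and_mem_and_mem (hM : IsRightIdealWitness M a b d e f)
    (hN : IsRightIdealWitness N b a d e' f') {p p' : σ} (hpp' : p ≠ p') (q q' : τ) :
    ∃ w, ¬(w ∈ M.acceptsFrom p ↔ w ∈ M.acceptsFrom p') ∧
      w ∈ N.acceptsFrom q ∧ w ∈ N.acceptsFrom q' := by
  obtain ⟨u, hu, hq⟩ := hM.exists_evalFrom_ne_and_eq_final hN hpp' q
  obtain ⟨v, hv, hq'⟩ := hM.exists_evalFrom_ne_and_eq_final hN hu (N.evalFrom q' u)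
  obtain ⟨w, hw⟩ : ∃ w, ¬(w ∈ M.acceptsFrom _ ↔ w ∈ M.acceptsFrom _) := by
    by_contra! h
    exact hv (hM.injective_acceptsFrom (Language.ext h))
  refine ⟨u ++ (v ++ w), ?_, ?_, ?_⟩
  · simpa only [DFA.mem_acceptsFrom, DFA.evalFrom_of_append] using hw
  · rw [hN.mem_acceptsFrom_iff, DFA.evalFrom_of_append, hq, hN.evalFrom_final]
  · rw [hN.mem_acceptsFrom_iff, DFA.evalFrom_of_append, DFA.evalFrom_of_append, hq',
      hN.evalFrom_final]

theorem exists_notMem_and_mem_and_notMem (hM : IsRightIdealWitness M a b d e f)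
    (hN : IsRightIdealWitness N b a d e' f') {p p' : σ} (hpp' : p ≠ p') (hp : p ≠ f)
    (hp' : p' ≠ f) {q : τ} (hq : q ≠ f') :
    ∃ w, w ∉ M.acceptsFrom p ∧ w ∈ M.acceptsFrom p' ∧ w ∉ N.acceptsFrom q := by
  obtain ⟨k, hk⟩ := hN.exists_replicate_a hq hN.start_ne_final
  have hb := hM.bijective_evalFrom_replicate_b k
  obtain ⟨j, hj, hj'⟩ := hM.exists_replicate_a_d_separates (hb.injective.ne hpp')
    (hM.evalFrom_ne_final hb hp) (hM.evalFrom_ne_final hb hp')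
  simp only [hM.mem_acceptsFrom_iff, hN.mem_acceptsFrom_iff]
  refine ⟨List.replicate k b ++ (List.replicate j a ++ [d]), ?_, ?_, ?_⟩
  · rwa [DFA.evalFrom_of_append]
  · rwa [DFA.evalFrom_of_append]
  · rw [DFA.evalFrom_of_append, hk, DFA.evalFrom_append_singleton, hN.evalFrom_start_replicate_b,
      hN.step_start_d]
    exact hN.start_ne_final

theorem quotientComplexity_boolOp_of_injective (hM : IsRightIdealWitness M a b d e f)
    (hN : IsRightIdealWitness N b a d e' f') {φ : Prop → Prop → Prop}
    (hleft : Function.Injective (φ · True)) (hright : Function.Injective (φ True)) :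
    quotientComplexity (boolOp φ M.accepts N.accepts) = ENat.card σ * ENat.card τ := by
  rw [quotientComplexity_boolOp_accepts (hM.surjective_eval_prod hN), ← ENat.card_prod]
  refine encard_range_of_injective ?_
  rintro ⟨p, q⟩ ⟨p', q'⟩ h
  have hiff (w : List α) : φ (w ∈ M.acceptsFrom p) (w ∈ N.acceptsFrom q) ↔
      φ (w ∈ M.acceptsFrom p') (w ∈ N.acceptsFrom q') := Set.ext_iff.1 h w
  rw [Prod.mk.injEq]
  constructor <;> by_contra hne
  · obtain ⟨w, hw, hq, hq'⟩ := hM.exists_not_mem_iff_and_mem_and_mem hN hne q q'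
    have hφ := hiff w
    simp only [hq, hq'] at hφ
    exact hw (iff_of_eq (hleft (propext hφ)))
  · obtain ⟨w, hw, hp, hp'⟩ := hN.exists_not_mem_iff_and_mem_and_mem hM hne p p'
    have hφ := hiff w
    simp only [hp, hp'] at hφ
    exact hw (iff_of_eq (hright (propext hφ)))

theorem quotientComplexity_inf (hM : IsRightIdealWitness M a b d e f)
    (hN : IsRightIdealWitness N b a d e' f') :
    quotientComplexity (M.accepts ⊓ N.accepts) = ENat.card σ * ENat.card τ :=
  hM.quotientComplexity_boolOp_of_injective hN (φ := And) (fun x y h => by simpa using h)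
    fun x y h => by simpa using h

theorem quotientComplexity_symmDiff (hM : IsRightIdealWitness M a b d e f)
    (hN : IsRightIdealWitness N b a d e' f') :
    quotientComplexity (symmDiff M.accepts N.accepts) = ENat.card σ * ENat.card τ :=
  hM.quotientComplexity_boolOp_of_injective hN (φ := Xor)
    (fun x y h => by simpa [xor_comm _ True, not_iff_not] using h)
    fun x y h => by simpa [not_iff_not] using h

theorem quotientComplexity_sdiff (hM : IsRightIdealWitness M a b d e f)
    (hN : IsRightIdealWitness N b a d e' f') :
    quotientComplexity (M.accepts \ N.accepts) = ENat.card σ * (ENat.card τ - 1) + 1 := by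
  change quotientComplexity (boolOp (fun x y => x ∧ ¬y) M.accepts N.accepts) = _
  rw [quotientComplexity_boolOp_accepts (hM.surjective_eval_prod hN), ← encard_compl_singleton f',
    ← Set.encard_univ, ← Set.encard_prod]
  refine encard_range_of_constant_off ⟨(f, f'), by simp⟩ ?_ ?_
  · rintro ⟨p, q⟩ hs ⟨p', q'⟩ ht
    obtain rfl : q = f' := by simpa using hs
    obtain rfl : q' = q := by simpa using ht
    ext w
    simp [mem_boolOp, hN.mem_acceptsFrom_final]
  · rintro ⟨p, q⟩ hs ⟨p', q'⟩ h
    have hq : q ≠ f' := by simpa using hs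
    have hiff (w : List α) : w ∈ M.acceptsFrom p ∧ w ∉ N.acceptsFrom q ↔
        w ∈ M.acceptsFrom p' ∧ w ∉ N.acceptsFrom q' := Set.ext_iff.1 h w
    obtain rfl : q = q' := by
      by_contra hqq'
      obtain ⟨w, hw, hp, hp'⟩ := hN.exists_not_mem_iff_and_mem_and_mem hM hqq' p p'
      have := hiff w
      tauto
    have hnil : p = f ↔ p' = f := by
      simpa [hM.mem_acceptsFrom_iff, hN.mem_acceptsFrom_iff, hq] using hiff []
    rw [Prod.mk.injEq]
    refine ⟨?_, rfl⟩
    by_contra hpp'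
    have hp : p ≠ f := fun hp => hpp' (hp.trans (hnil.1 hp).symm)
    obtain ⟨w, hwp, hwp', hwq⟩ :=
      hM.exists_notMem_and_mem_and_notMem hN hpp' hp (mt hnil.2 hp) hq
    exact hwp ((hiff w).2 ⟨hwp', hwq⟩).1

theorem quotientComplexity_sup (hM : IsRightIdealWitness M a b d e f)
    (hN : IsRightIdealWitness N b a d e' f') :
    quotientComplexity (M.accepts ⊔ N.accepts) = (ENat.card σ - 1) * (ENat.card τ - 1) + 1 := by
  change quotientComplexity (boolOp Or M.accepts N.accepts) = _
  rw [quotientComplexity_boolOp_accepts (hM.surjective_eval_prod hN), ← encard_compl_singleton f,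
    ← encard_compl_singleton f', ← Set.encard_prod]
  refine encard_range_of_constant_off ⟨(f, f'), by simp⟩ ?_ ?_
  · have htop {s : σ × τ} (hs : s ∉ ({f}ᶜ ×ˢ {f'}ᶜ : Set (σ × τ))) (w : List α) :
        w ∈ boolOp Or (M.acceptsFrom s.1) (N.acceptsFrom s.2) := by
      have hs' : s.1 = f ∨ s.2 = f' := by simpa [or_iff_not_imp_left] using hs
      rcases hs' with h | h
      · exact Or.inl (h ▸ hM.mem_acceptsFrom_final w)
      · exact Or.inr (h ▸ hN.mem_acceptsFrom_final w)
    exact fun s hs t ht => Set.ext fun w => iff_of_true (htop hs w) (htop ht w)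
  · rintro ⟨p, q⟩ ⟨hp, hq⟩ ⟨p', q'⟩ h
    have hiff (w : List α) : w ∈ M.acceptsFrom p ∨ w ∈ N.acceptsFrom q ↔
        w ∈ M.acceptsFrom p' ∨ w ∈ N.acceptsFrom q' := Set.ext_iff.1 h w
    have hnil : ¬(p' = f ∨ q' = f') := by
      have := (hiff []).not.1
      simp only [hM.mem_acceptsFrom_iff, hN.mem_acceptsFrom_iff, DFA.evalFrom_nil] at this
      exact this (not_or.2 ⟨hp, hq⟩)
    obtain ⟨hp', hq'⟩ := not_or.1 hnil
    rw [Prod.mk.injEq]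
    constructor <;> by_contra hne
    · obtain ⟨w, hwp, hwp', hwq⟩ := hM.exists_notMem_and_mem_and_notMem hN hne hp hp' hq
      exact not_or.2 ⟨hwp, hwq⟩ ((hiff w).2 (Or.inl hwp'))
    · obtain ⟨w, hwq, hwq', hwp⟩ := hN.exists_notMem_and_mem_and_notMem hM hne hq hq' hp
      exact not_or.2 ⟨hwp, hwq⟩ ((hiff w).2 (Or.inr hwq'))

end Pair

end IsRightIdealWitness

section RightIdealDFA

variable {n : ℕ}

theorem val_step_rightIdealDFA_a (hn : 3 ≤ n) {p : Fin n} (hp : p.val < n - 1) :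
    ((rightIdealDFA n hn).step p Letter.a).val = (p.val + 1) % (n - 1) := by
  simp only [rightIdealDFA]
  split_ifs with h h'
  · exact (Nat.mod_eq_of_lt (by grind)).symm
  · rw [show p.val + 1 = n - 1 by omega, Nat.mod_self]
  · omega

theorem val_evalFrom_rightIdealDFA_replicate_a (hn : 3 ≤ n) {p : Fin n} (hp : p.val < n - 1)
    (k : ℕ) : ((rightIdealDFA n hn).evalFrom p (List.replicate k Letter.a)).val =
      (p.val + k) % (n - 1) := by
  induction k with
  | zero => exact (Nat.mod_eq_of_lt hp).symm
  | succ k ih =>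
    have hlt : (p.val + k) % (n - 1) < n - 1 := Nat.mod_lt _ (by omega)
    rw [List.replicate_succ', DFA.evalFrom_append_singleton,
      val_step_rightIdealDFA_a hn (ih.trans_lt hlt), ih, Nat.mod_add_mod, add_assoc]

theorem exists_evalFrom_rightIdealDFA_replicate_a (hn : 3 ≤ n) {p q : Fin n} (hp : p.val < n - 1)
    (hq : q.val < n - 1) :
    ∃ k, (rightIdealDFA n hn).evalFrom p (List.replicate k Letter.a) = q := by
  refine ⟨q.val + (n - 1 - p.val), Fin.ext ?_⟩
  rw [val_evalFrom_rightIdealDFA_replicate_a hn hp,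
    show p.val + (q.val + (n - 1 - p.val)) = q.val + (n - 1) by omega, Nat.add_mod_right,
    Nat.mod_eq_of_lt hq]

theorem isRightIdealWitness_rightIdealDFA (hn : 3 ≤ n) :
    IsRightIdealWitness (rightIdealDFA n hn) Letter.a Letter.b Letter.d
      ⟨n - 2, by omega⟩ ⟨n - 1, by omega⟩ where
  accept_eq := rfl
  step_final x := by
    cases x <;> ext <;> simp only [rightIdealDFA] <;> split_ifs <;> grind
  bijective_step_a := Finite.injective_iff_bijective.1 fun p q h => by
    simp only [rightIdealDFA] at h
    grind
  exists_replicate_a hp hq := exists_evalFrom_rightIdealDFA_replicate_a hn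
    (by grind) (by grind)
  bijective_step_b := Finite.injective_iff_bijective.1 fun p q h => by
    simp only [rightIdealDFA] at h
    grind
  step_start_b := by
    simp only [rightIdealDFA]
    grind
  step_exit_d := by
    simp only [rightIdealDFA]
    grind
  step_d_of_ne hp := by
    simp only [rightIdealDFA]
    grind
  start_ne_exit := by
    simp only [rightIdealDFA]
    grind
  start_ne_final := by
    simp only [rightIdealDFA]
    grind
  exit_ne_final := by grind

end RightIdealDFA

section Dialect

variable {α : Type*} {π : α ≃. α} {Γ : Set α} {g : Γ → α}

theorem map_eq_map_some_iff (hg : ∀ y : Γ, π.symm y = some (g y)) {v : List α} {w : List Γ} :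
    v.map π = (w.map Subtype.val).map some ↔ v = w.map g := by
  have hπ (x : α) (y : Γ) : π x = some y.val ↔ x = g y := by
    rw [← π.eq_some_iff, hg, Option.some_inj, eq_comm]
  induction v generalizing w with
  | nil => cases w <;> simp
  | cons x v ih =>
    cases w with
    | nil => simp
    | cons y w => simp only [List.map_cons, List.cons.injEq, hπ, ih]

theorem overAlphabet_dialect_accepts {σ : Type*} (hg : ∀ y : Γ, π.symm y = some (g y))
    (M : DFA α σ) : overAlphabet Γ (dialect π M.accepts) = (M.comap g).accepts := by
  ext w
  rw [DFA.accepts_comap]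
  change (∃ v ∈ M.accepts, v.map π = (w.map Subtype.val).map some) ↔ w.map g ∈ M.accepts
  simp only [map_eq_map_some_iff hg, exists_eq_right]

end Dialect

section DialectDFA

/-- The letter `a` of the alphabet `{a, b, d}`. -/
def letterA : alphabetABD := ⟨Letter.a, by simp [alphabetABD]⟩

/-- The letter `b` of the alphabet `{a, b, d}`. -/
def letterB : alphabetABD := ⟨Letter.b, by simp [alphabetABD]⟩

/-- The letter `d` of the alphabet `{a, b, d}`. -/
def letterD : alphabetABD := ⟨Letter.d, by simp [alphabetABD]⟩

/-- The DFA `D_n(a, b, -, d)`. -/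
def dfaAB (n : ℕ) (hn : 3 ≤ n) : DFA alphabetABD (Fin n) :=
  (rightIdealDFA n hn).comap Subtype.val

/-- The DFA `D_n(b, a, -, d)`. -/
def dfaBA (n : ℕ) (hn : 3 ≤ n) : DFA alphabetABD (Fin n) :=
  (rightIdealDFA n hn).comap fun x => Equiv.swap Letter.a Letter.b x

variable {n : ℕ} (hn : 3 ≤ n)

theorem langAB_eq_accepts : langAB n hn = (dfaAB n hn).accepts :=
  overAlphabet_dialect_accepts (by rintro ⟨_, rfl | rfl | rfl⟩ <;> rfl) (rightIdealDFA n hn)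

theorem langBA_eq_accepts : langBA n hn = (dfaBA n hn).accepts :=
  overAlphabet_dialect_accepts (by rintro ⟨_, rfl | rfl | rfl⟩ <;> rfl) (rightIdealDFA n hn)

theorem isRightIdealWitness_dfaAB :
    IsRightIdealWitness (dfaAB n hn) letterA letterB letterD
      ⟨n - 2, by omega⟩ ⟨n - 1, by omega⟩ :=
  (isRightIdealWitness_rightIdealDFA hn).comap

theorem isRightIdealWitness_dfaBA :
    IsRightIdealWitness (dfaBA n hn) letterB letterA letterD
      ⟨n - 2, by omega⟩ ⟨n - 1, by omega⟩ :=
  (isRightIdealWitness_rightIdealDFA hn).comap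

end DialectDFA

theorem mainTheorem7_general {α σ τ : Type*} {M : DFA α σ} {N : DFA α τ} {a b d : α} {e f : σ}
    {e' f' : τ} (hM : IsRightIdealWitness M a b d e f) (hN : IsRightIdealWitness N b a d e' f') :
    quotientComplexity (M.accepts ⊓ N.accepts) = ENat.card σ * ENat.card τ ∧
    quotientComplexity (symmDiff M.accepts N.accepts) = ENat.card σ * ENat.card τ ∧
    quotientComplexity (M.accepts \ N.accepts) = ENat.card σ * (ENat.card τ - 1) + 1 ∧
    quotientComplexity (M.accepts ⊔ N.accepts) = (ENat.card σ - 1) * (ENat.card τ - 1) + 1 :=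
  ⟨hM.quotientComplexity_inf hN, hM.quotientComplexity_symmDiff hN, hM.quotientComplexity_sdiff hN,
    hM.quotientComplexity_sup hN⟩

theorem mainTheorem7 (m n : ℕ) (hm : 3 ≤ m) (hn : 3 ≤ n) :
    quotientComplexity (langAB m hm ⊓ langBA n hn) = ((m * n : ℕ) : ℕ∞) ∧
    quotientComplexity (symmDiff (langAB m hm) (langBA n hn)) = ((m * n : ℕ) : ℕ∞) ∧
    quotientComplexity (langAB m hm \ langBA n hn) = ((m * n - (m - 1) : ℕ) : ℕ∞) ∧
    quotientComplexity (langAB m hm ⊔ langBA n hn) = ((m * n - (m + n - 2) : ℕ) : ℕ∞) := by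
  have hsdiff : m * n - (m - 1) = m * (n - 1) + 1 := by
    rw [Nat.mul_sub_one]
    have := Nat.le_mul_of_pos_right m (show 0 < n by omega)
    omega
  have hsup : m * n - (m + n - 2) = (m - 1) * (n - 1) + 1 := by
    obtain ⟨m, rfl⟩ := Nat.exists_eq_add_of_le' (show 1 ≤ m by omega)
    obtain ⟨n, rfl⟩ := Nat.exists_eq_add_of_le' (show 1 ≤ n by omega)
    rw [add_tsub_cancel_right, add_tsub_cancel_right, add_one_mul, mul_add_one]
    omega
  rw [langAB_eq_accepts, langBA_eq_accepts, hsdiff, hsup]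
  simpa using
    mainTheorem7_general (isRightIdealWitness_dfaAB hm) (isRightIdealWitness_dfaBA hn)
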